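/- Let $k\ge 4$ be even and put $a=k/2$; let $m\ge a$, let $\mathcal R=\{R_1,\dots,R_m\}$ and $\mathcal C=\{C_1,\dots,C_m\}$ be disjoint $m$-sets, and let $\mathcal P=\mathcal R\times\mathcal C$. Let $\Delta=C_k$ be the cycle of length $k$ in the complete bipartite graph on $\mathcal R\cup\mathcal C$ with edges $\{R_i,C_i\}$ ($1\le i\le a$), $\{R_{i+1},C_i\}$ ($1\le i\le a-1$) and $\{R_1,C_a\}$, and let $B=\{(R,C)\in\mathcal P : \{R,C\}\text{ is an edge of }\Delta\}$. Let $K=\mathrm{Sym}(\mathcal R)\times\mathrm{Sym}(\mathcal C)$ act on $\mathcal P$ in the product action, and let $G=\langle K,\tau\rangle\cong S_m\wr S_2$, where $\tau:(R_i,C_j)\mapsto(R_j,C_i)$. Let $\mathcal D(\Delta)$ and $\widehat{\mathcal D}(\Delta)$ be the incidence structures with point set $\mathcal P$ and block sets $\{B^g: g\in K\}$ and $\{B^g: g\in G\}$ respectively. For positive integers $t,v,\kappa,\lambda$, a $t$-$(v,\kappa,\lambda)$ design is an incidence structure with $v$ points, all blocks of size $\kappa$, and every $t$-element set of points contained in exactly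 $\lambda$ blocks; a $t$-design is a $t$-$(v,\kappa,\lambda)$ design for some positive $v,\kappa,\lambda$. A group of automorphisms is flag-transitive if it is transitive on the incident point-block pairs. Then $\mathcal D(\Delta)=\widehat{\mathcal D}(\Delta)=:\mathcal D$ is a $1$-$(m^2,k,\lambda_1)$ design for some $\lambda_1$, and both $K$ and $G$ are flag-transitive on $\mathcal D$. If $m\neq 2$ (that is, apart from the trivial case $(m,k)=(2,4)$, in which the only block is $\mathcal P$), then $\mathcal D$ is not a $3$-design. Moreover $\mathcal D$ is a $2$-design if and only if $m=k-2$, in which case $\mathcal D$ is a $2$-$((k-2)^2,k,\lambda)$ design with $$\lambda=\frac{(k-3)!\,(k-4)!}{\big((k/2-2)!\big)^2}.$$ -/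

import Mathlib

open scoped Nat

namespace GridDesign

/-- A point-block incidence structure on the point set `P`: blocks are subsets of `P`,
incidence is membership. -/
@[ext]
structure IncidenceStructure (P : Type*) where
  /-- The set of blocks. -/
  blocks : Set (Set P)

/-- `D` is a `t`-`(v, k, lam)` design, for positive integers `t, v, k, lam`: there are `v` points,
every block has size `k`, and every `t`-element set of points lies in exactly `lam` blocks. -/
structure IncidenceStructure.IsDesign {P : Type*} (D : IncidenceStructure P)
    (t v k lam : ℕ) : Prop where
  t_pos : 0 < t
  v_pos : 0 < v
  k_pos : 0 < k
  lam_pos : 0 < lam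
  card_points : Nat.card P = v
  card_block : ∀ b ∈ D.blocks, b.ncard = k
  card_blocks_containing : ∀ T : Finset P, T.card = t →
    {b ∈ D.blocks | (T : Set P) ⊆ b}.ncard = lam

/-- `D` is a `t`-design: a `t`-`(v, k, lam)` design for some `v, k, lam`. -/
def IncidenceStructure.IsTDesign {P : Type*} (D : IncidenceStructure P) (t : ℕ) : Prop :=
  ∃ v k lam : ℕ, D.IsDesign t v k lam

/-- The permutation group `H` on the points acts flag-transitively on `D`: it consists of
automorphisms of `D`, and it is transitive on the incident point-block pairs. -/
def IncidenceStructure.IsFlagTransitive {P : Type*} (D : IncidenceStructure P)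
    (H : Subgroup (Equiv.Perm P)) : Prop :=
  (∀ g ∈ H, ∀ b : Set P, g '' b ∈ D.blocks ↔ b ∈ D.blocks) ∧
    ∀ b ∈ D.blocks, ∀ p ∈ b, ∀ b' ∈ D.blocks, ∀ p' ∈ b', ∃ g ∈ H, g p = p' ∧ g '' b = b'

/-- The points of the square grid: pairs (row, column). -/
abbrev Grid (m : ℕ) : Type := Fin m × Fin m

/-- `Sym(R) × Sym(C)` in its product action on the points of the grid. -/
def groupK (m : ℕ) : Subgroup (Equiv.Perm (Grid m)) where
  carrier := {g | ∃ σ ρ : Equiv.Perm (Fin m), g = Equiv.prodCongr σ ρ}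
  one_mem' := ⟨1, 1, rfl⟩
  mul_mem' := by
    rintro _ _ ⟨σ, ρ, rfl⟩ ⟨σ', ρ', rfl⟩
    exact ⟨σ * σ', ρ * ρ', rfl⟩
  inv_mem' := by
    rintro _ ⟨σ, ρ, rfl⟩
    exact ⟨σ⁻¹, ρ⁻¹, rfl⟩

/-- The transposition `(R_i, C_j) ↦ (R_j, C_i)` of the grid. -/
def tau (m : ℕ) : Equiv.Perm (Grid m) := Equiv.prodComm (Fin m) (Fin m)

/-- The group generated by `Sym(R) × Sym(C)` and the transposition, i.e. the wreath product
of `Sym(m)` with `Sym(2)` in its product action. -/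
def groupG (m : ℕ) : Subgroup (Equiv.Perm (Grid m)) :=
  Subgroup.closure ((groupK m : Set (Equiv.Perm (Grid m))) ∪ {tau m})

/-- The set of points `(R, C)` such that `{R, C}` is an edge of the graph `Δ`, a subgraph of the
complete bipartite graph whose vertices are the rows `inl i` and the columns `inr j`. -/
def blockOf {m : ℕ} (Δ : SimpleGraph (Fin m ⊕ Fin m)) : Set (Grid m) :=
  {p | Δ.Adj (Sum.inl p.1) (Sum.inr p.2)}

/-- The block of the image of `Δ` under an element of `Sym(R) × Sym(C)` acting on vertices is the
image of the block of `Δ` in the product action. -/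
theorem blockOf_map_sumCongr {m : ℕ} (Δ : SimpleGraph (Fin m ⊕ Fin m))
    (σ ρ : Equiv.Perm (Fin m)) :
    blockOf (Δ.map (Equiv.sumCongr σ ρ)) = Equiv.prodCongr σ ρ '' blockOf Δ := by
  ext ⟨i, j⟩
  simp only [blockOf, Set.mem_ofPred_eq, Set.mem_image]
  constructor
  · rintro ⟨-, u | u, v | v, h, hu, hv⟩ <;> simp at hu hv
    exact ⟨(u, v), h, by simp [hu, hv]⟩
  · rintro ⟨⟨u, v⟩, h, huv⟩
    simp only [Equiv.prodCongr_apply, Prod.map_apply, Prod.mk.injEq] at huv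
    exact ⟨by simp, _, _, h, by simp [huv.1], by simp [huv.2]⟩

/-- The block of the image of `Δ` under the vertex map that swaps `R_i` and `C_i` for all `i`
is the image of the block of `Δ` under the transposition of the grid. -/
theorem blockOf_map_sumComm {m : ℕ} (Δ : SimpleGraph (Fin m ⊕ Fin m)) :
    blockOf (Δ.map (Equiv.sumComm (Fin m) (Fin m))) = tau m '' blockOf Δ := by
  ext ⟨i, j⟩
  simp only [blockOf, Set.mem_ofPred_eq, Set.mem_image]
  constructor
  · rintro ⟨-, u | u, v | v, h, hu, hv⟩ <;> simp at hu hv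
    exact ⟨(v, u), h.symm, by simp [tau, hu, hv]⟩
  · rintro ⟨⟨u, v⟩, h, huv⟩
    simp only [tau, Equiv.prodComm_apply, Prod.swap_prod_mk, Prod.mk.injEq] at huv
    exact ⟨by simp, _, _, h.symm, by simp [huv.1], by simp [huv.2]⟩

/-- The incidence structure on the grid whose blocks are the images under `H` of the block of `Δ`,
i.e. (by the two facts above) the blocks of the images of `Δ` under `H`. -/
def designOf {m : ℕ} (H : Subgroup (Equiv.Perm (Grid m))) (Δ : SimpleGraph (Fin m ⊕ Fin m)) :
    IncidenceStructure (Grid m) where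
  blocks := {b | ∃ g ∈ H, b = g '' blockOf Δ}

/-- The incidence structure `D(Δ)`. -/
def designD {m : ℕ} (Δ : SimpleGraph (Fin m ⊕ Fin m)) : IncidenceStructure (Grid m) :=
  designOf (groupK m) Δ

/-- The incidence structure `D̂(Δ)`. -/
def designDhat {m : ℕ} (Δ : SimpleGraph (Fin m ⊕ Fin m)) : IncidenceStructure (Grid m) :=
  designOf (groupG m) Δ

/-- The cycle of length `k = 2a ≥ 4` in the complete bipartite graph on `m` rows and `m ≥ a`
columns. Numbering rows and columns from `0`, its edges are `{R_i, C_i}` for `i < a`,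
`{R_{i+1}, C_i}` for `i + 1 < a`, and `{R_0, C_{a-1}}`. -/
def evenCycle (m k : ℕ) : SimpleGraph (Fin m ⊕ Fin m) :=
  SimpleGraph.fromEdgeSet {e | ∃ i j : Fin m, e = s(Sum.inl i, Sum.inr j) ∧
    ((i.val = j.val ∧ j.val < k / 2) ∨
      (i.val = j.val + 1 ∧ j.val + 1 < k / 2) ∨
      (i.val = 0 ∧ j.val + 1 = k / 2))}

end GridDesign

/-!
All the counting takes place at one point `o` of the grid. If `H` is flag-transitive and `b` is a
block through `o`, the point stabilizer `H_o` permutes the blocks through `o` transitively, so their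
number is `r = |H_o| / |H_{o,b}|`; and for every suborbit `Γ = H_o q`, double counting the pairs
`q' ∈ Γ ∩ b'` with `o ∈ b'` gives `|Γ| λ(o, q) = r |Γ ∩ b|`.

In the product action the nontrivial suborbits at `o` are the rest of the row, the rest of the
column, and the remaining `(m - 1)²` points; a block through `o` meets them in `1`, `1` and `k - 3`
points. So `λ` is constant exactly when `(k - 3) / (m - 1)² = 1 / (m - 1)`, i.e. `m = k - 2`. The
dihedral symmetries of the cycle give flag-transitivity, and a permutation of rows and columns that
fixes a flag of the cycle fixes the whole cycle, so `r = ((m - 1)! / (m - k/2)!)²`.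
-/

namespace GridDesign

open Equiv MulAction
open scoped Pointwise

namespace IncidenceStructure

variable {P : Type*} {D : IncidenceStructure P} {H : Subgroup (Perm P)}

/-- The full automorphism group of `D`: the stabilizer of the set of blocks in the induced action
on sets of sets of points. -/
def automorphismGroup (D : IncidenceStructure P) : Subgroup (Perm P) :=
  stabilizer (Perm P) D.blocks

theorem mem_automorphismGroup {g : Perm P} :
    g ∈ D.automorphismGroup ↔ ∀ b : Set P, g • b ∈ D.blocks ↔ b ∈ D.blocks :=
  mem_stabilizer_set

/-- The blocks of `D` that contain every point of `T`. -/
def blocksThrough (D : IncidenceStructure P) (T : Set P) : Set (Set P) :=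
  {b ∈ D.blocks | T ⊆ b}

theorem blocksThrough_smul {g : Perm P} (hg : g ∈ D.automorphismGroup) (T : Set P) :
    D.blocksThrough (g • T) = g • D.blocksThrough T := by
  ext b
  have hb : g⁻¹ • b ∈ D.blocks ↔ b ∈ D.blocks := mem_automorphismGroup.1 (inv_mem hg) b
  simp only [blocksThrough, Set.mem_smul_set_iff_inv_smul_mem, Set.mem_ofPred_eq, hb,
    Set.subset_smul_set_iff, inv_inv]

theorem ncard_blocksThrough_smul {g : Perm P} (hg : g ∈ D.automorphismGroup) (T : Set P) :
    (D.blocksThrough (g • T)).ncard = (D.blocksThrough T).ncard := by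
  rw [blocksThrough_smul hg, Set.ncard_smul_set]

theorem exists_isDesign_one [Finite P] {k : ℕ} (hk : 0 < k) (hblocks : D.blocks.Nonempty)
    (hcard : ∀ b ∈ D.blocks, b.ncard = k) (htrans : IsPretransitive D.automorphismGroup P) :
    ∃ lam, D.IsDesign 1 (Nat.card P) k lam := by
  obtain ⟨b, hb⟩ := hblocks
  obtain ⟨p, hp⟩ : b.Nonempty := Set.nonempty_of_ncard_ne_zero (by rw [hcard b hb]; exact hk.ne')
  have : Nonempty P := ⟨p⟩
  refine ⟨(D.blocksThrough {p}).ncard, one_pos, Nat.card_pos, hk, ?_, rfl, hcard, fun T hT => ?_⟩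
  · exact (Set.ncard_pos (Set.toFinite _)).2 ⟨b, hb, Set.singleton_subset_iff.2 hp⟩
  · obtain ⟨q, rfl⟩ := Finset.card_eq_one.1 hT
    obtain ⟨⟨g, hg⟩, rfl⟩ := htrans.exists_smul_eq p q
    rw [← ncard_blocksThrough_smul hg, Set.smul_set_singleton, Finset.coe_singleton]
    rfl

namespace IsFlagTransitive

theorem le_automorphismGroup (hD : D.IsFlagTransitive H) : H ≤ D.automorphismGroup :=
  fun g hg => mem_automorphismGroup.2 (hD.1 g hg)

theorem mono {H' : Subgroup (Perm P)} (hD : D.IsFlagTransitive H) (hle : H ≤ H')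
    (haut : H' ≤ D.automorphismGroup) : D.IsFlagTransitive H' := by
  refine ⟨fun g hg => mem_automorphismGroup.1 (haut hg), fun b hb p hp b' hb' p' hp' => ?_⟩
  obtain ⟨g, hg, hgpb⟩ := hD.2 b hb p hp b' hb' p' hp'
  exact ⟨g, hle hg, hgpb⟩

variable {p : P} {b : Set P}

theorem orbit_pointStabilizer_block (hD : D.IsFlagTransitive H) (hb : b ∈ D.blocks) (hp : p ∈ b) :
    orbit ↥(H ⊓ stabilizer (Perm P) p) b = D.blocksThrough {p} := by
  ext b'
  constructor
  · rintro ⟨⟨g, hg, hgp⟩, rfl⟩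
    refine ⟨(hD.1 g hg b).2 hb, Set.singleton_subset_iff.2 ?_⟩
    exact ⟨p, hp, hgp⟩
  · rintro ⟨hb', hp'⟩
    obtain ⟨g, hg, hgp, rfl⟩ := hD.2 b hb p hp b' hb' p (Set.singleton_subset_iff.1 hp')
    exact ⟨⟨g, hg, hgp⟩, rfl⟩

theorem ncard_blocksThrough_point_mul_card (hD : D.IsFlagTransitive H) (hb : b ∈ D.blocks)
    (hp : p ∈ b) :
    (D.blocksThrough {p}).ncard *
        Nat.card ↥(H ⊓ stabilizer (Perm P) p ⊓ stabilizer (Perm P) b) =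
      Nat.card ↥(H ⊓ stabilizer (Perm P) p) := by
  have hstab : (stabilizer ↥(H ⊓ stabilizer (Perm P) p) b).map (Subgroup.subtype _) =
      H ⊓ stabilizer (Perm P) p ⊓ stabilizer (Perm P) b := by
    ext g
    simp only [Subgroup.mem_map, Subgroup.mem_inf, Subtype.exists]
    constructor
    · rintro ⟨g, hg, hgb, rfl⟩
      exact ⟨hg, hgb⟩
    · rintro ⟨hg, hgb⟩
      exact ⟨g, hg, hgb, rfl⟩
  rw [← hstab, Subgroup.card_subtype, ← hD.orbit_pointStabilizer_block hb hp,
    ← index_stabilizer, Subgroup.index_mul_card]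

/-- Both sides count the pairs of a point `q'` in the suborbit of `q` and a block through `p`
and `q'`. -/
theorem ncard_suborbit_mul_ncard_blocksThrough_pair [Finite P] (hD : D.IsFlagTransitive H)
    (hb : b ∈ D.blocks) (hp : p ∈ b) (q : P) :
    (orbit ↥(H ⊓ stabilizer (Perm P) p) q).ncard * (D.blocksThrough {p, q}).ncard =
      (D.blocksThrough {p}).ncard * (orbit ↥(H ⊓ stabilizer (Perm P) p) q ∩ b).ncard := by
  classical
  have := Fintype.ofFinite P
  simp only [Set.ncard_eq_toFinset_card']
  refine Finset.card_mul_eq_card_mul (fun q' b' => q' ∈ b') (fun q' hq' => ?_) fun b' hb' => ?_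
  · have hpair : D.blocksThrough {p, q'} =
        (D.blocksThrough {p}).toFinset.bipartiteAbove (fun q' b' => q' ∈ b') q' := by
      ext b'
      rw [Finset.mem_coe, Finset.mem_bipartiteAbove, Set.mem_toFinset]
      simp only [blocksThrough, Set.insert_subset_iff, Set.singleton_subset_iff, Set.mem_ofPred_eq,
        and_assoc]
    obtain ⟨⟨g, hg, hgp : g • p = p⟩, rfl : g • q = q'⟩ := Set.mem_toFinset.1 hq'
    rw [← Set.ncard_coe_finset, ← hpair, ← Set.ncard_eq_toFinset_card',
      ← ncard_blocksThrough_smul (hD.le_automorphismGroup hg) {p, q}, Set.smul_set_insert,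
      Set.smul_set_singleton, hgp]
  · rw [Set.mem_toFinset, ← hD.orbit_pointStabilizer_block hb hp] at hb'
    obtain ⟨g, rfl⟩ := hb'
    rw [← Set.ncard_eq_toFinset_card', ← Set.ncard_smul_set g, Set.smul_set_inter, smul_orbit,
      ← Set.ncard_coe_finset]
    congr 1
    ext
    simp [Finset.bipartiteBelow]

end IsFlagTransitive

end IncidenceStructure

theorem card_fixingSubgroup_perm {α : Type*} [Finite α] (s : Set α) :
    Nat.card (fixingSubgroup (Perm α) s) = (Nat.card α - s.ncard)! := by
  have hindex := IsMultiplyPretransitive.index_of_fixingSubgroup_mul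
    (Perm.isMultiplyPretransitive α s.ncard) (s := s) rfl
  rw [← Nat.card_perm, ← (fixingSubgroup (Perm α) s).index_mul_card] at hindex
  exact (Nat.eq_of_mul_eq_mul_left (Nat.pos_of_ne_zero Subgroup.index_ne_zero_of_finite)
    hindex).symm

/-- The product action of `Sym(α) × Sym(β)` on `α × β`. -/
def prodCongrHom (α β : Type*) : Perm α × Perm β →* Perm (α × β) where
  toFun x := prodCongr x.1 x.2
  map_one' := rfl
  map_mul' _ _ := rfl

theorem prodCongrHom_injective {α β : Type*} [Nonempty α] [Nonempty β] :
    Function.Injective (prodCongrHom α β) := by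
  rintro ⟨σ, ρ⟩ ⟨σ', ρ'⟩ hg
  have happly (i : α) (j : β) : (σ i, ρ j) = (σ' i, ρ' j) := DFunLike.congr_fun hg (i, j)
  inhabit α
  inhabit β
  exact Prod.ext (Perm.ext fun i => congrArg Prod.fst (happly i default))
    (Perm.ext fun j => congrArg Prod.snd (happly default j))

section Design

open IncidenceStructure

variable {m : ℕ} {H H' : Subgroup (Perm (Grid m))} {Δ : SimpleGraph (Fin m ⊕ Fin m)}

theorem blocks_designOf : (designOf H Δ).blocks = orbit H (blockOf Δ) := by
  ext b
  constructor
  · rintro ⟨g, hg, rfl⟩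
    exact ⟨⟨g, hg⟩, rfl⟩
  · rintro ⟨⟨g, hg⟩, rfl⟩
    exact ⟨g, hg, rfl⟩

theorem blockOf_mem_blocks_designOf : blockOf Δ ∈ (designOf H Δ).blocks :=
  blocks_designOf ▸ mem_orbit_self _

theorem le_automorphismGroup_designOf : H ≤ (designOf H Δ).automorphismGroup := fun g hg => by
  rw [automorphismGroup, mem_stabilizer_iff, blocks_designOf]
  exact smul_orbit (⟨g, hg⟩ : H) (blockOf Δ)

theorem ncard_eq_of_mem_blocks_designOf {b : Set (Grid m)} (hb : b ∈ (designOf H Δ).blocks) :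
    b.ncard = (blockOf Δ).ncard := by
  obtain ⟨g, -, rfl⟩ := hb
  exact Set.ncard_image_of_injective _ g.injective

theorem designOf_eq_designOf (hle : H ≤ H') (haut : H' ≤ (designOf H Δ).automorphismGroup) :
    designOf H Δ = designOf H' Δ := by
  ext b
  constructor
  · rintro ⟨g, hg, rfl⟩
    exact ⟨g, hle hg, rfl⟩
  · rintro ⟨g, hg, rfl⟩
    exact (mem_automorphismGroup.1 (haut hg) _).2 blockOf_mem_blocks_designOf

theorem isFlagTransitive_designOf {o : Grid m}
    (htrans : ∀ p ∈ blockOf Δ, ∃ g ∈ H ⊓ stabilizer (Perm (Grid m)) (blockOf Δ), g • o = p) :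
    (designOf H Δ).IsFlagTransitive H := by
  have hflag : ∀ b ∈ (designOf H Δ).blocks, ∀ p ∈ b, ∃ g ∈ H, g • o = p ∧ g • blockOf Δ = b := by
    rintro _ ⟨g, hg, rfl⟩ _ ⟨q, hq, rfl⟩
    obtain ⟨x, ⟨hx, hxB⟩, rfl⟩ := htrans q hq
    exact ⟨g * x, mul_mem hg hx, rfl, by rw [mul_smul, mem_stabilizer_iff.1 hxB]; rfl⟩
  refine ⟨fun g hg => mem_automorphismGroup.1 (le_automorphismGroup_designOf hg), ?_⟩
  intro b hb p hp b' hb' p' hp'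
  obtain ⟨g, hg, rfl, rfl⟩ := hflag b hb p hp
  obtain ⟨g', hg', rfl, rfl⟩ := hflag b' hb' p' hp'
  refine ⟨g' * g⁻¹, mul_mem hg' (inv_mem hg), ?_, ?_⟩
  · change (g' * g⁻¹) • g • o = g' • o
    rw [mul_smul, inv_smul_smul]
  · change (g' * g⁻¹) • g • blockOf Δ = g' • blockOf Δ
    rw [mul_smul, inv_smul_smul]

theorem groupK_le_groupG : groupK m ≤ groupG m :=
  fun _ hg => Subgroup.subset_closure (Or.inl hg)

theorem tau_mem_groupG : tau m ∈ groupG m :=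
  Subgroup.subset_closure (Or.inr rfl)

theorem groupG_le_automorphismGroup (htau : tau m • blockOf Δ ∈ (designD Δ).blocks) :
    groupG m ≤ (designD Δ).automorphismGroup := by
  have haut : groupK m ≤ (designD Δ).automorphismGroup := le_automorphismGroup_designOf
  refine (Subgroup.closure_le _).2 (Set.union_subset haut (Set.singleton_subset_iff.2 ?_))
  refine (mem_stabilizer_set' (Set.toFinite _)).2 ?_
  rintro _ ⟨_, ⟨σ, ρ, rfl⟩, rfl⟩
  have hconj : tau m * prodCongr σ ρ = prodCongr ρ σ * tau m := rfl
  change tau m • (prodCongr σ ρ : Perm (Grid m)) • blockOf Δ ∈ _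
  rw [smul_smul, hconj, mul_smul]
  exact (mem_automorphismGroup.1 (haut ⟨ρ, σ, rfl⟩) _).2 htau

theorem exists_mem_groupK_smul_eq (p q : Grid m) : ∃ g ∈ groupK m, g • p = q :=
  ⟨_, ⟨swap p.1 q.1, swap p.2 q.2, rfl⟩,
    Prod.ext (swap_apply_left p.1 q.1) (swap_apply_left p.2 q.2)⟩

theorem isPretransitive_automorphismGroup_designD :
    IsPretransitive (designD Δ).automorphismGroup (Grid m) where
  exists_smul_eq p q := by
    obtain ⟨g, hg, hgpq⟩ := exists_mem_groupK_smul_eq p q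
    exact ⟨⟨g, le_automorphismGroup_designOf hg⟩, hgpq⟩

end Design

section CycleBlock

variable {m : ℕ} {c : Perm (Fin m)} {o : Fin m}

/-- The edge set of a graph on `m` rows and `m` columns in which row `i` and column `i` are joined
by an edge, and column `j` is joined to row `c j`, for all `i` and `j` in the support of `c`. If
`c` is an `a`-cycle, this is a cycle of length `2a`, read as a set of points of the grid. -/
def cycleBlock (c : Perm (Fin m)) : Set (Grid m) :=
  {p | p.2 ∈ c.support ∧ (p.1 = p.2 ∨ p.1 = c p.2)}

theorem mem_cycleBlock_iff_fst_mem_support {i j : Fin m} :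
    (i, j) ∈ cycleBlock c ↔ i ∈ c.support ∧ (i = j ∨ i = c j) := by
  refine and_congr_left ?_
  rintro ((h : i = j) | (h : i = c j))
  · rw [h]
  · rw [h, Perm.apply_mem_support]

theorem ncard_cycleBlock : (cycleBlock c).ncard = 2 * c.support.card := by
  have hunion : cycleBlock c =
      (fun j => (j, j)) '' (c.support : Set (Fin m)) ∪ (fun j => (c j, j)) '' c.support := by
    ext ⟨i, j⟩
    simp only [cycleBlock, Set.mem_ofPred_eq, Set.mem_union, Set.mem_image, Finset.mem_coe,
      Prod.mk.injEq]
    grind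
  have hdisj : Disjoint ((fun j => (j, j)) '' (c.support : Set (Fin m)))
      ((fun j => (c j, j)) '' c.support) := by
    rw [Set.disjoint_left]
    rintro _ ⟨j, hj, rfl⟩ ⟨j', -, hj'⟩
    obtain ⟨hfix, rfl⟩ := Prod.mk.inj hj'
    exact Perm.mem_support.1 hj hfix
  rw [hunion, Set.ncard_union_eq hdisj,
    Set.ncard_image_of_injective _ (fun _ _ h => congrArg Prod.snd h),
    Set.ncard_image_of_injective _ (fun _ _ h => congrArg Prod.snd h), Set.ncard_coe_finset,
    two_mul]

theorem tau_smul_cycleBlock (c : Perm (Fin m)) :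
    tau m • cycleBlock c = (prodCongr 1 c : Perm (Grid m)) • cycleBlock c := by
  ext ⟨i, j⟩
  rw [Set.mem_smul_set_iff_inv_smul_mem, Set.mem_smul_set_iff_inv_smul_mem]
  change (j, i) ∈ cycleBlock c ↔ (i, c.symm j) ∈ cycleBlock c
  rw [mem_cycleBlock_iff_fst_mem_support]
  have hsupp : c.symm j ∈ c.support ↔ j ∈ c.support := by
    rw [← Perm.apply_mem_support, apply_symm_apply]
  simp only [cycleBlock, Set.mem_ofPred_eq, apply_symm_apply, hsupp, eq_symm_apply]
  tauto

theorem prodCongr_self_mem_stabilizer_cycleBlock {σ : Perm (Fin m)} (hσ : Commute σ c) :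
    (prodCongr σ σ : Perm (Grid m)) ∈ stabilizer (Perm (Grid m)) (cycleBlock c) := by
  refine (mem_stabilizer_set' (Set.toFinite _)).2 ?_
  rintro ⟨i, j⟩ ⟨hj, hij⟩
  exact ⟨(Perm.mem_support_iff_of_commute hσ j).2 hj,
    hij.imp (congrArg σ) fun h => (congrArg σ h).trans (DFunLike.congr_fun hσ j)⟩

/-- The reflections of the cycle: they exchange the edges `(j, j)` and the edges `(c j, j)`. -/
theorem prodCongr_mul_mem_stabilizer_cycleBlock {ρ : Perm (Fin m)} (hρ : ρ * c * ρ⁻¹ = c⁻¹) :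
    (prodCongr (c * ρ) ρ : Perm (Grid m)) ∈ stabilizer (Perm (Grid m)) (cycleBlock c) := by
  have hinvert (j : Fin m) : c (ρ (c j)) = ρ j := by
    have h : c * ρ * c = ρ := by rw [mul_assoc, mul_inv_eq_iff_eq_mul.1 hρ, mul_inv_cancel_left]
    exact DFunLike.congr_fun h j
  refine (mem_stabilizer_set' (Set.toFinite _)).2 ?_
  rintro ⟨i, j⟩ ⟨hj, hij⟩
  refine ⟨Perm.mem_support.2 fun hfix : c (ρ j) = ρ j => Perm.mem_support.1 hj ?_, ?_⟩
  · exact ρ.injective (c.injective ((hinvert j).trans hfix.symm))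
  · rcases hij with (rfl : i = j) | (rfl : i = c j)
    · exact Or.inr rfl
    · exact Or.inl (hinvert j)

theorem exists_mem_stabilizer_cycleBlock_smul_eq (hc : c.IsCycle) (ho : o ∈ c.support)
    {p : Grid m} (hp : p ∈ cycleBlock c) :
    ∃ g ∈ groupK m ⊓ stabilizer (Perm (Grid m)) (cycleBlock c), g • (o, o) = p := by
  have hrot (n : ℤ) : (prodCongr (c ^ n) (c ^ n) : Perm (Grid m)) ∈
      groupK m ⊓ stabilizer (Perm (Grid m)) (cycleBlock c) :=
    ⟨⟨_, _, rfl⟩, prodCongr_self_mem_stabilizer_cycleBlock ((Commute.refl c).zpow_left n)⟩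
  obtain ⟨i, j⟩ := p
  obtain ⟨hj, (rfl : i = j) | (rfl : i = c j)⟩ := hp
  · obtain ⟨n, rfl⟩ := hc.exists_zpow_eq (Perm.mem_support.1 ho) (Perm.mem_support.1 hj)
    exact ⟨_, hrot n, rfl⟩
  · obtain ⟨ρ, hρ⟩ := isConj_iff.1 (hc.isConj hc.inv (by rw [Perm.support_inv]))
    have href := prodCongr_mul_mem_stabilizer_cycleBlock hρ
    have hρo : ρ o ∈ c.support := by
      have h : (c (ρ o), ρ o) ∈ cycleBlock c :=
        (mem_stabilizer_set.1 href (o, o)).2 ⟨ho, Or.inl rfl⟩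
      exact h.1
    obtain ⟨n, rfl⟩ := hc.exists_zpow_eq (Perm.mem_support.1 hρo) (Perm.mem_support.1 hj)
    refine ⟨_, mul_mem (hrot n) ⟨⟨_, _, rfl⟩, href⟩, Prod.ext ?_ rfl⟩
    exact DFunLike.congr_fun ((Commute.refl c).zpow_left n) (ρ o)

/-- The group of all pairs `(σ, ρ)` of permutations of the rows and columns that fix `s`
pointwise, in the product action. -/
def fixingProd (s : Set (Fin m)) : Subgroup (Perm (Grid m)) :=
  ((fixingSubgroup (Perm (Fin m)) s).prod (fixingSubgroup (Perm (Fin m)) s)).map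
    (prodCongrHom (Fin m) (Fin m))

theorem card_fixingProd [Nonempty (Fin m)] (s : Set (Fin m)) :
    Nat.card (fixingProd s) = (m - s.ncard)! ^ 2 := by
  rw [fixingProd, Subgroup.card_map_of_injective prodCongrHom_injective,
    Nat.card_congr (Subgroup.prodEquiv _ _).toEquiv, Nat.card_prod, card_fixingSubgroup_perm,
    Nat.card_fin, sq]

theorem mem_fixingProd {s : Set (Fin m)} {σ ρ : Perm (Fin m)} (hσ : ∀ i ∈ s, σ i = i)
    (hρ : ∀ i ∈ s, ρ i = i) : (prodCongr σ ρ : Perm (Grid m)) ∈ fixingProd s :=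
  ⟨(σ, ρ), ⟨(mem_fixingSubgroup_iff _).2 hσ, (mem_fixingSubgroup_iff _).2 hρ⟩, rfl⟩

theorem groupK_inf_stabilizer (o : Fin m) :
    groupK m ⊓ stabilizer (Perm (Grid m)) (o, o) = fixingProd {o} := by
  ext g
  constructor
  · rintro ⟨⟨σ, ρ, rfl⟩, hg⟩
    obtain ⟨hσ : σ o = o, hρ : ρ o = o⟩ := Prod.mk.inj hg
    exact mem_fixingProd (by rintro _ rfl; exact hσ) (by rintro _ rfl; exact hρ)
  · rintro ⟨⟨σ, ρ⟩, ⟨hσ, hρ⟩, rfl⟩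
    exact ⟨⟨σ, ρ, rfl⟩, Prod.ext ((mem_fixingSubgroup_iff _).1 hσ o rfl)
      ((mem_fixingSubgroup_iff _).1 hρ o rfl)⟩

theorem apply_eq_of_mem_stabilizer_cycleBlock {σ ρ : Perm (Fin m)}
    (hB : (prodCongr σ ρ : Perm (Grid m)) ∈ stabilizer (Perm (Grid m)) (cycleBlock c))
    {j : Fin m} (hj : j ∈ c.support) (hσ : σ j = j) (hρ : ρ j = j) :
    σ (c j) = c j ∧ ρ (c j) = c j := by
  have hmaps (p : Grid m) (hp : p ∈ cycleBlock c) : (σ p.1, ρ p.2) ∈ cycleBlock c :=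
    (mem_stabilizer_set.1 hB p).2 hp
  have hcj : c j ∈ c.support := Perm.apply_mem_support.2 hj
  have hcj_ne : c j ≠ j := Perm.mem_support.1 hj
  have hσ' : σ (c j) = c j := by
    rcases (hmaps (c j, j) ⟨hj, Or.inr rfl⟩).2 with (h : σ (c j) = ρ j) | (h : σ (c j) = c (ρ j))
    · rw [hρ, ← hσ, σ.injective.eq_iff, hσ] at h
      exact absurd h hcj_ne
    · rwa [hρ] at h
  refine ⟨hσ', ?_⟩
  rcases (hmaps (c j, c j) ⟨hcj, Or.inl rfl⟩).2 with (h : σ (c j) = ρ (c j)) |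
    (h : σ (c j) = c (ρ (c j)))
  · rw [← h, hσ']
  · rw [hσ', c.injective.eq_iff, ← hρ, ρ.injective.eq_iff, hρ] at h
    exact absurd h.symm hcj_ne

theorem groupK_inf_stabilizer_inf_stabilizer_cycleBlock (hc : c.IsCycle) (ho : o ∈ c.support) :
    groupK m ⊓ stabilizer (Perm (Grid m)) (o, o) ⊓ stabilizer (Perm (Grid m)) (cycleBlock c) =
      fixingProd c.support := by
  ext g
  constructor
  · rintro ⟨⟨⟨σ, ρ, rfl⟩, hg⟩, hB⟩
    have hfix : ∀ i ∈ c.support, σ i = i ∧ ρ i = i := by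
      intro i hi
      obtain ⟨n, rfl⟩ := hc.exists_pow_eq (Perm.mem_support.1 ho) (Perm.mem_support.1 hi)
      clear hi
      induction n with
      | zero => exact Prod.mk.inj hg
      | succ n ih =>
        rw [pow_succ', Perm.mul_apply]
        exact apply_eq_of_mem_stabilizer_cycleBlock hB (Perm.pow_apply_mem_support.2 ho) ih.1 ih.2
    exact mem_fixingProd (fun i hi => (hfix i hi).1) fun i hi => (hfix i hi).2
  · rintro ⟨⟨σ, ρ⟩, ⟨hσ, hρ⟩, rfl⟩
    have hσ : ∀ i ∈ c.support, σ i = i := (mem_fixingSubgroup_iff _).1 hσ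
    have hρ : ∀ i ∈ c.support, ρ i = i := (mem_fixingSubgroup_iff _).1 hρ
    refine ⟨⟨⟨σ, ρ, rfl⟩, Prod.ext (hσ o ho) (hρ o ho)⟩,
      (mem_stabilizer_set' (Set.toFinite _)).2 ?_⟩
    rintro ⟨i, j⟩ hij
    have hfix : prodCongrHom _ _ (σ, ρ) • (i, j) = (i, j) :=
      Prod.ext (hσ i (mem_cycleBlock_iff_fst_mem_support.1 hij).1) (hρ j hij.1)
    rwa [hfix]

theorem orbit_groupK_inf_stabilizer (i j o : Fin m) :
    orbit ↥(groupK m ⊓ stabilizer (Perm (Grid m)) (o, o)) (i, j) =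
      {p | (p.1 = o ↔ i = o) ∧ (p.2 = o ↔ j = o)} := by
  ext ⟨i', j'⟩
  constructor
  · rintro ⟨⟨_, ⟨σ, ρ, rfl⟩, hg⟩, hgp⟩
    obtain ⟨hσ : σ o = o, hρ : ρ o = o⟩ := Prod.mk.inj hg
    obtain ⟨rfl : σ i = i', rfl : ρ j = j'⟩ := Prod.mk.inj hgp
    exact ⟨σ.injective.eq_iff' hσ, ρ.injective.eq_iff' hρ⟩
  · rintro ⟨hi : i' = o ↔ i = o, hj : j' = o ↔ j = o⟩
    have hswap {x y : Fin m} (hxy : y = o ↔ x = o) : swap x y o = o := by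
      by_cases hx : x = o
      · rw [hx, hxy.2 hx, swap_self, refl_apply]
      · exact swap_apply_of_ne_of_ne (Ne.symm hx) fun h => hx (hxy.1 h.symm)
    exact ⟨⟨prodCongr (swap i i') (swap j j'), ⟨_, _, rfl⟩, Prod.ext (hswap hi) (hswap hj)⟩,
      Prod.ext (swap_apply_left i i') (swap_apply_left j j')⟩

theorem row_inter_cycleBlock (ho : o ∈ c.support) :
    ({o} : Set (Fin m)) ×ˢ ({o}ᶜ : Set (Fin m)) ∩ cycleBlock c = {(o, c.symm o)} := by
  ext ⟨i, j⟩
  simp only [Set.mem_inter_iff, Set.mem_prod, Set.mem_singleton_iff, Set.mem_compl_iff,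
    mem_cycleBlock_iff_fst_mem_support, Prod.mk.injEq, eq_symm_apply]
  have hco : c o ≠ o := Perm.mem_support.1 ho
  grind

theorem ncard_general_inter_cycleBlock (ho : o ∈ c.support) :
    (({o}ᶜ : Set (Fin m)) ×ˢ ({o}ᶜ : Set (Fin m)) ∩ cycleBlock c).ncard =
      2 * c.support.card - 3 := by
  have hco : c o ≠ o := Perm.mem_support.1 ho
  have hsymm : c.symm o ≠ o := fun h => hco (c.symm_apply_eq.1 h).symm
  have hinter : ({o}ᶜ : Set (Fin m)) ×ˢ ({o}ᶜ : Set (Fin m)) ∩ cycleBlock c =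
      cycleBlock c \ {(o, o), (o, c.symm o), (c o, o)} := by
    ext ⟨i, j⟩
    simp only [Set.mem_inter_iff, Set.mem_prod, Set.mem_singleton_iff, Set.mem_compl_iff,
      Set.mem_sdiff, Set.mem_insert_iff, mem_cycleBlock_iff_fst_mem_support, Prod.mk.injEq,
      eq_symm_apply]
    grind
  have hsub : {(o, o), (o, c.symm o), (c o, o)} ⊆ cycleBlock c := by
    have hco_mem : c o ∈ c.support := Perm.apply_mem_support.2 ho
    simp [Set.insert_subset_iff, mem_cycleBlock_iff_fst_mem_support, -Perm.mem_support, ho, hco_mem]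
  rw [hinter, Set.ncard_sdiff hsub, ncard_cycleBlock, Set.ncard_eq_three.2]
  exact ⟨(o, o), (o, c.symm o), (c o, o), by simp [hsymm.symm], by simp [hco.symm],
    by simp [hco.symm], rfl⟩

theorem ncard_le_two_of_subset_cycleBlock {s : Set (Grid m)} (hs : s ⊆ cycleBlock c) {i : Fin m}
    (hrow : ∀ p ∈ s, p.1 = i) : s.ncard ≤ 2 := by
  have hpair : ({(i, i), (i, c.symm i)} : Set (Grid m)).ncard ≤ 2 :=
    (Set.ncard_insert_le _ _).trans_eq (by rw [Set.ncard_singleton])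
  refine (Set.ncard_le_ncard ?_).trans hpair
  rintro ⟨i', j⟩ hp
  obtain rfl : i' = i := hrow _ hp
  rcases (mem_cycleBlock_iff_fst_mem_support.1 (hs hp)).2 with rfl | rfl
  · exact Or.inl rfl
  · exact Or.inr (Prod.ext rfl (c.symm_apply_apply j).symm)

end CycleBlock

section Counting

open IncidenceStructure

variable {m : ℕ} {c : Perm (Fin m)} {o : Fin m} {Δ : SimpleGraph (Fin m ⊕ Fin m)}

theorem designD_isFlagTransitive (hΔ : blockOf Δ = cycleBlock c) (hc : c.IsCycle) :
    (designD Δ).IsFlagTransitive (groupK m) := by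
  obtain ⟨o, ho⟩ := hc.nonempty_support
  refine isFlagTransitive_designOf (o := (o, o)) fun p hp => ?_
  rw [hΔ] at hp ⊢
  exact exists_mem_stabilizer_cycleBlock_smul_eq hc ho hp

theorem groupG_le_automorphismGroup_designD (hΔ : blockOf Δ = cycleBlock c) :
    groupG m ≤ (designD Δ).automorphismGroup := by
  refine groupG_le_automorphismGroup ?_
  rw [hΔ, tau_smul_cycleBlock, ← hΔ]
  exact ⟨_, ⟨1, c, rfl⟩, rfl⟩

theorem ncard_blocksThrough_point_mul_factorial (hΔ : blockOf Δ = cycleBlock c) (hc : c.IsCycle)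
    (ho : o ∈ c.support) :
    ((designD Δ).blocksThrough {(o, o)}).ncard * (m - c.support.card)! ^ 2 = (m - 1)! ^ 2 := by
  have : Nonempty (Fin m) := ⟨o⟩
  have hoB : (o, o) ∈ blockOf Δ := hΔ ▸ ⟨ho, Or.inl rfl⟩
  have hcount := (designD_isFlagTransitive hΔ hc).ncard_blocksThrough_point_mul_card
    blockOf_mem_blocks_designOf hoB
  rwa [hΔ, groupK_inf_stabilizer_inf_stabilizer_cycleBlock hc ho, groupK_inf_stabilizer,
    card_fixingProd, card_fixingProd, Set.ncard_singleton, Set.ncard_coe_finset] at hcount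

theorem ncard_compl_singleton (o : Fin m) : ({o}ᶜ : Set (Fin m)).ncard = m - 1 := by
  rw [Set.ncard_compl, Set.ncard_singleton, Nat.card_fin]

theorem sub_one_mul_ncard_blocksThrough_row (hΔ : blockOf Δ = cycleBlock c) (hc : c.IsCycle)
    (ho : o ∈ c.support) {j : Fin m} (hj : j ≠ o) :
    (m - 1) * ((designD Δ).blocksThrough {(o, o), (o, j)}).ncard =
      ((designD Δ).blocksThrough {(o, o)}).ncard := by
  have hoB : (o, o) ∈ blockOf Δ := hΔ ▸ ⟨ho, Or.inl rfl⟩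
  have horbit : orbit ↥(groupK m ⊓ stabilizer (Perm (Grid m)) (o, o)) (o, j) =
      ({o} : Set (Fin m)) ×ˢ ({o}ᶜ : Set (Fin m)) := by
    ext
    simp [orbit_groupK_inf_stabilizer, hj]
  have hcount := (designD_isFlagTransitive hΔ hc).ncard_suborbit_mul_ncard_blocksThrough_pair
    blockOf_mem_blocks_designOf hoB (o, j)
  rwa [horbit, hΔ, row_inter_cycleBlock ho, Set.ncard_prod, Set.ncard_singleton,
    Set.ncard_singleton, ncard_compl_singleton, one_mul, mul_one] at hcount

theorem sub_one_mul_ncard_blocksThrough_column (hΔ : blockOf Δ = cycleBlock c) (hc : c.IsCycle)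
    (ho : o ∈ c.support) {i : Fin m} (hi : i ≠ o) :
    (m - 1) * ((designD Δ).blocksThrough {(o, o), (i, o)}).ncard =
      ((designD Δ).blocksThrough {(o, o)}).ncard := by
  have htau : ({(o, o), (i, o)} : Set (Grid m)) = tau m • {(o, o), (o, i)} := by
    rw [Set.smul_set_insert, Set.smul_set_singleton]
    rfl
  rw [htau, ncard_blocksThrough_smul (groupG_le_automorphismGroup_designD hΔ tau_mem_groupG),
    sub_one_mul_ncard_blocksThrough_row hΔ hc ho hi]

theorem sub_one_sq_mul_ncard_blocksThrough_general (hΔ : blockOf Δ = cycleBlock c)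
    (hc : c.IsCycle) (ho : o ∈ c.support) {i j : Fin m} (hi : i ≠ o) (hj : j ≠ o) :
    (m - 1) ^ 2 * ((designD Δ).blocksThrough {(o, o), (i, j)}).ncard =
      ((designD Δ).blocksThrough {(o, o)}).ncard * (2 * c.support.card - 3) := by
  have hoB : (o, o) ∈ blockOf Δ := hΔ ▸ ⟨ho, Or.inl rfl⟩
  have horbit : orbit ↥(groupK m ⊓ stabilizer (Perm (Grid m)) (o, o)) (i, j) =
      ({o}ᶜ : Set (Fin m)) ×ˢ ({o}ᶜ : Set (Fin m)) := by
    ext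
    simp [orbit_groupK_inf_stabilizer, hi, hj]
  have hcount := (designD_isFlagTransitive hΔ hc).ncard_suborbit_mul_ncard_blocksThrough_pair
    blockOf_mem_blocks_designOf hoB (i, j)
  rwa [horbit, hΔ, ncard_general_inter_cycleBlock ho, Set.ncard_prod, ncard_compl_singleton,
    ← sq] at hcount

theorem sub_one_mul_ncard_blocksThrough_pair (hΔ : blockOf Δ = cycleBlock c) (hc : c.IsCycle)
    (ho : o ∈ c.support) (hm : m - 1 = 2 * c.support.card - 3) {p q : Grid m} (hpq : p ≠ q) :
    (m - 1) * ((designD Δ).blocksThrough {p, q}).ncard =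
      ((designD Δ).blocksThrough {(o, o)}).ncard := by
  obtain ⟨g, hg, rfl : g • (o, o) = p⟩ := exists_mem_groupK_smul_eq (o, o) p
  obtain ⟨⟨i, j⟩, rfl⟩ := MulAction.surjective g q
  have haut : g ∈ (designD Δ).automorphismGroup := le_automorphismGroup_designOf hg
  rw [← Set.smul_set_singleton, ← Set.smul_set_insert, ncard_blocksThrough_smul haut]
  by_cases hi : i = o <;> by_cases hj : j = o
  · exact absurd (by rw [hi, hj]) hpq
  · rw [hi, sub_one_mul_ncard_blocksThrough_row hΔ hc ho hj]
  · rw [hj, sub_one_mul_ncard_blocksThrough_column hΔ hc ho hi]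
  · have hgeneral := sub_one_sq_mul_ncard_blocksThrough_general hΔ hc ho hi hj
    have hpos : 0 < m - 1 := by
      have := hc.two_le_card_support
      omega
    rw [← hm, mul_comm _ (m - 1), sq, mul_assoc] at hgeneral
    exact Nat.eq_of_mul_eq_mul_left hpos hgeneral

theorem ncard_blocksThrough_point_pos (hΔ : blockOf Δ = cycleBlock c) (hc : c.IsCycle)
    (ho : o ∈ c.support) : 0 < ((designD Δ).blocksThrough {(o, o)}).ncard := by
  have hr := ncard_blocksThrough_point_mul_factorial hΔ hc ho
  exact Nat.pos_of_mul_pos_right (hr ▸ pow_pos (Nat.factorial_pos _) 2)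

theorem exists_designD_isDesign_one (hΔ : blockOf Δ = cycleBlock c) (hc : c.IsCycle) :
    ∃ lam, (designD Δ).IsDesign 1 (m ^ 2) (2 * c.support.card) lam := by
  have hpoints : m ^ 2 = Nat.card (Grid m) := by rw [Nat.card_prod, Nat.card_fin, sq]
  have hblock : 2 * c.support.card = (blockOf Δ).ncard := by rw [hΔ, ncard_cycleBlock]
  have hpos : 0 < 2 * c.support.card := by
    have := hc.two_le_card_support
    omega
  rw [hpoints, hblock]
  exact exists_isDesign_one (hblock ▸ hpos) ⟨_, blockOf_mem_blocks_designOf⟩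
    (fun _ => ncard_eq_of_mem_blocks_designOf) isPretransitive_automorphismGroup_designD

theorem exists_designD_isDesign_two (hΔ : blockOf Δ = cycleBlock c) (hc : c.IsCycle)
    (hm : m - 1 = 2 * c.support.card - 3) :
    ∃ lam, lam * (m - c.support.card)! ^ 2 = (m - 1)! * (m - 2)! ∧
      (designD Δ).IsDesign 2 (m ^ 2) (2 * c.support.card) lam := by
  obtain ⟨o, ho⟩ := hc.nonempty_support
  obtain ⟨lam₁, hD₁⟩ := exists_designD_isDesign_one hΔ hc
  have hpos : 0 < m - 1 := by
    have := hc.two_le_card_support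
    omega
  have hoco : (o, o) ≠ (o, c o) := fun h => Perm.mem_support.1 ho (congrArg Prod.snd h).symm
  have hlam := sub_one_mul_ncard_blocksThrough_pair hΔ hc ho hm hoco
  have hr := ncard_blocksThrough_point_mul_factorial hΔ hc ho
  refine ⟨((designD Δ).blocksThrough {(o, o), (o, c o)}).ncard, ?_, two_pos, hD₁.v_pos, hD₁.k_pos,
    ?_, hD₁.card_points, hD₁.card_block, fun T hT => ?_⟩
  · rw [← hlam, sq (m - 1)!] at hr
    refine Nat.eq_of_mul_eq_mul_left hpos ?_
    rw [← mul_assoc, hr, mul_left_comm]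
    congr 1
    exact (Nat.mul_factorial_pred hpos.ne').symm
  · exact Nat.pos_of_mul_pos_left (hlam ▸ ncard_blocksThrough_point_pos hΔ hc ho)
  · obtain ⟨p, q, hpq, rfl⟩ := Finset.card_eq_two.1 hT
    rw [Finset.coe_pair]
    exact Nat.eq_of_mul_eq_mul_left hpos
      ((sub_one_mul_ncard_blocksThrough_pair hΔ hc ho hm hpq).trans hlam.symm)

theorem sub_one_eq_of_isTDesign_two (hΔ : blockOf Δ = cycleBlock c) (hc : c.IsCycle)
    (hD : (designD Δ).IsTDesign 2) : m - 1 = 2 * c.support.card - 3 := by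
  obtain ⟨v, k, lam, hD⟩ := hD
  obtain ⟨o, ho⟩ := hc.nonempty_support
  have hco : c o ≠ o := Perm.mem_support.1 ho
  have hpair (q : Grid m) (hq : (o, o) ≠ q) :
      ((designD Δ).blocksThrough {(o, o), q}).ncard = lam := by
    rw [← hD.card_blocks_containing {(o, o), q} (Finset.card_pair hq), Finset.coe_pair]
    rfl
  have hrow := sub_one_mul_ncard_blocksThrough_row hΔ hc ho hco
  have hgeneral := sub_one_sq_mul_ncard_blocksThrough_general hΔ hc ho hco hco
  rw [hpair _ fun h => hco (congrArg Prod.snd h).symm] at hrow hgeneral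
  refine Nat.eq_of_mul_eq_mul_left (ncard_blocksThrough_point_pos hΔ hc ho) ?_
  rw [← hgeneral, ← hrow]
  ring

theorem not_isTDesign_three (hΔ : blockOf Δ = cycleBlock c) (hm : 3 ≤ m) :
    ¬ (designD Δ).IsTDesign 3 := by
  rintro ⟨v, k, lam, hD⟩
  have : NeZero m := ⟨by omega⟩
  obtain ⟨t, -, ht⟩ := Finset.exists_subset_card_eq (s := (Finset.univ : Finset (Fin m)))
    (hm.trans_eq (Finset.card_fin m).symm)
  have hcard : (({0} : Finset (Fin m)) ×ˢ t).card = 3 := by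
    rw [Finset.card_product, Finset.card_singleton, one_mul, ht]
  refine hD.lam_pos.ne' ((hD.card_blocks_containing _ hcard).symm.trans ?_)
  rw [Set.ncard_eq_zero, Set.eq_empty_iff_forall_notMem]
  rintro _ ⟨⟨g, ⟨σ, ρ, rfl⟩, rfl⟩, hsub⟩
  have hsub' : (prodCongr σ ρ : Perm (Grid m))⁻¹ • (({0} ×ˢ t : Finset (Grid m)) : Set (Grid m)) ⊆
      cycleBlock c := Set.subset_smul_set_iff.1 (hΔ ▸ hsub)
  have hle := ncard_le_two_of_subset_cycleBlock hsub' (i := σ.symm 0) (by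
    rintro _ ⟨p, hp, rfl⟩
    exact congrArg σ.symm (Finset.mem_singleton.1 (Finset.mem_product.1 hp).1))
  rw [Set.ncard_smul_set, Set.ncard_coe_finset, hcard] at hle
  omega

end Counting

section EvenCycle

theorem mem_blockOf_evenCycle {m k : ℕ} {i j : Fin m} :
    (i, j) ∈ blockOf (evenCycle m k) ↔
      (i.val = j.val ∧ j.val < k / 2) ∨ (i.val = j.val + 1 ∧ j.val + 1 < k / 2) ∨
        (i.val = 0 ∧ j.val + 1 = k / 2) := by
  simp only [blockOf, evenCycle, Set.mem_ofPred_eq, SimpleGraph.fromEdgeSet_adj]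
  constructor
  · rintro ⟨⟨i', j', hij, h⟩, -⟩
    obtain ⟨rfl, rfl⟩ : i = i' ∧ j = j' := by simpa using hij
    exact h
  · exact fun h => ⟨⟨i, j, rfl, h⟩, by simp⟩

theorem mem_support_cycleRange {m : ℕ} [NeZero m] {l j : Fin m} (hl : l ≠ 0) :
    j ∈ l.cycleRange.support ↔ j ≤ l := by
  rw [Perm.mem_support]
  rcases lt_or_ge l j with hj | hj
  · simp [Fin.cycleRange_of_gt hj, hj]
  · simp only [ne_eq, hj, iff_true, Fin.ext_iff, Fin.coe_cycleRange_of_le hj]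
    have hl' : l.val ≠ 0 := Fin.val_ne_zero_iff.2 hl
    split_ifs <;> omega

theorem exists_isCycle_blockOf_evenCycle {m a : ℕ} (ha : 2 ≤ a) (ham : a ≤ m) :
    ∃ c : Perm (Fin m), c.IsCycle ∧ c.support.card = a ∧
      blockOf (evenCycle m (2 * a)) = cycleBlock c := by
  have : NeZero m := ⟨by omega⟩
  let l : Fin m := ⟨a - 1, by omega⟩
  have hl : l ≠ 0 := Fin.val_ne_zero_iff.1 (by simp only [l]; omega)
  refine ⟨l.cycleRange, Fin.isCycle_cycleRange hl, ?_, ?_⟩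
  · rw [← Perm.sum_cycleType, Fin.cycleType_cycleRange hl, Multiset.sum_singleton]
    exact Nat.sub_add_cancel (by omega)
  · ext ⟨i, j⟩
    rw [mem_blockOf_evenCycle, Nat.mul_div_cancel_left a two_pos]
    simp only [cycleBlock, Set.mem_ofPred_eq, mem_support_cycleRange hl]
    rcases le_or_gt j l with hj | hj
    · simp only [Fin.ext_iff, Fin.coe_cycleRange_of_le hj, hj, true_and]
      have hja : j.val ≤ a - 1 := hj
      have hla : l.val = a - 1 := rfl
      split_ifs <;> omega
    · have hja : a - 1 < j.val := hj
      simp only [hj.not_ge, false_and, iff_false]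
      omega

end EvenCycle

end GridDesign

open GridDesign in
theorem lemma4p5 (m k : ℕ) (hk : Even k) (hk4 : 4 ≤ k) (hkm : k / 2 ≤ m) :
    designD (evenCycle m k) = designDhat (evenCycle m k) ∧
    (∃ lam : ℕ, (designD (evenCycle m k)).IsDesign 1 (m ^ 2) k lam) ∧
    (designD (evenCycle m k)).IsFlagTransitive (groupK m) ∧
    (designD (evenCycle m k)).IsFlagTransitive (groupG m) ∧
    (m ≠ 2 → ¬ (designD (evenCycle m k)).IsTDesign 3) ∧
    ((designD (evenCycle m k)).IsTDesign 2 ↔ m = k - 2) ∧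
    (m = k - 2 → ∃ lam : ℕ,
      (lam : ℚ) = ((k - 3)! : ℚ) * ((k - 4)! : ℚ) / ((k / 2 - 2)! : ℚ) ^ 2 ∧
      (designD (evenCycle m k)).IsDesign 2 ((k - 2) ^ 2) k lam) := by
  obtain ⟨a, rfl⟩ := even_iff_exists_two_mul.1 hk
  rw [Nat.mul_div_cancel_left a two_pos] at hkm ⊢
  obtain ⟨c, hc, rfl, hΔ⟩ := exists_isCycle_blockOf_evenCycle (a := a) (by omega) hkm
  have haut := groupG_le_automorphismGroup_designD hΔ
  have hflag := designD_isFlagTransitive hΔ hc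
  have htwo (hm : m = 2 * c.support.card - 2) :=
    exists_designD_isDesign_two hΔ hc (by omega : m - 1 = 2 * c.support.card - 3)
  refine ⟨designOf_eq_designOf groupK_le_groupG haut, exists_designD_isDesign_one hΔ hc, hflag,
    hflag.mono groupK_le_groupG haut, fun hm => not_isTDesign_three hΔ (by omega),
    ⟨fun hD => ?_, fun hm => ?_⟩, fun hm => ?_⟩
  · have := sub_one_eq_of_isTDesign_two hΔ hc hD
    omega
  · obtain ⟨lam, -, hD⟩ := htwo hm
    exact ⟨_, _, lam, hD⟩
  · obtain ⟨lam, hlam, hD⟩ := htwo hm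
    refine ⟨lam, ?_, hm ▸ hD⟩
    rw [show m - c.support.card = c.support.card - 2 by omega,
      show m - 1 = 2 * c.support.card - 3 by omega,
      show m - 2 = 2 * c.support.card - 4 by omega] at hlam
    rw [eq_div_iff (pow_ne_zero 2 (Nat.cast_ne_zero.2 (Nat.factorial_ne_zero _)))]
    exact_mod_cast hlam
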